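/- Let $I^d_N$ be the $d$-dimensional grid: the cube $[0,N]^d$ dissected into $N^d$ unit cubes, with vertices ordered lexicographically and each edge $e$ directed from its minimal vertex $\min e$ to its maximal vertex $\max e$. Let $\#$ multiply a function on $2$-dimensional faces $f$ by $-1$ if $f$ is parallel to $(1,0,\dots,0)$ and by $+1$ otherwise. Let $G$ be a Lie group with a smooth unitary representation on $\mathbb{C}^n$; elements of $G$ are identified in the formulae below with the unitary matrices representing them. For $u\in G$ let $T_uG\subset\mathbb{C}^{n\times n}$ be the real linear subspace parallel to the tangent space of $G$ at $u$ (the image of the differential of the representation at $u$), and let $\mathrm{Pr}_{T_uG}\colon\mathbb{C}^{n\times n}\to T_uG$ be the orthogonal projection with respect to $\langle u,v\rangle=\mathrm{Re}\,\mathrm{Tr}[u^*v]$. Let $U$ (a gauge group field) and $j$ (a covariant current) be functions on the edges of $I^d_N$ with values in $G$ and $\mathbb{C}^{n\times n}$ respectively, and let $[\mathrm{Pr}_{T_UG}\,j](e)=\mathrm{Pr}_{T_{U(e)}G}\,j(e)$. For an oriented edge path $\pi$ let $U(\pi)$ be the ordered product of $U(e)^{\pm1}$ over the edges $e$ of $\pi$,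 the sign telling whether $e$ is passed along or against its direction. Assume that $U$ is generated by $j$, i.e., that $U$ is a stationary point, under variations of $U$ with values in $G$ and for fixed $j$, of $$\mathcal{S}[U]=\sum_{\text{2-faces } f}\#\left(\mathrm{Re}\,\mathrm{Tr}\,U(\partial f)-n\right)-\sum_{\text{edges } e}\mathrm{Re}\,\mathrm{Tr}\,[j^*(e)U(e)].$$ For an edge $e$, a vertex $v$ and a $\mathbb{C}^{n\times n}$-valued function $k$ on edges put $$[D_A^*\#F](e)=\sum_{\text{2-faces } f\supset e}\#\left(U(e)-U(\partial f-e)\right),\qquad [D_A^*k](v)=\sum_{e\text{ ending at }v}U(e)^{-1}k(e)-\sum_{e\text{ starting at }v}k(e)U(e)^{-1},$$ where $\partial f-e$ is the path from $\min e$ to $\max e$ consisting of the three edges of $f$ other than $e$. Then $U$ satisfies 1. the discrete Yang–Mills equation $-\mathrm{Pr}_{T_UG}\,D_A^*\#F=\mathrm{Pr}_{T_UG}\,j$ (at every edge), and 2. the charge conservation law $D_A^*\,\mathrm{Pr}_{T_UG}\,j=0$ (at every vertex). -/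

import Mathlib

open scoped Matrix Manifold ContDiff

noncomputable section

namespace LatticeGauge

/-! ### The scalar product of matrices -/

attribute [local instance] Matrix.frobeniusNormedAddCommGroup Matrix.frobeniusNormedSpace

/-- Square complex matrices as a real Euclidean space, with the scalar product
`⟨u, v⟩ = Re Tr (u^* v)`. Its norm is the Frobenius norm. -/
@[reducible] def matrixInnerProductSpace (n : ℕ) :
    InnerProductSpace ℝ (Matrix (Fin n) (Fin n) ℂ) where
  inner u v := (uᴴ * v).trace.re
  norm_sq_eq_re_inner u := by
    have h : (0 : ℝ) ≤ ∑ i, ∑ j, ‖u i j‖ ^ (2 : ℝ) := by positivity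
    rw [Matrix.frobenius_norm_def, ← Real.rpow_natCast, ← Real.rpow_mul h]
    norm_num
    rw [Finset.sum_comm]
    simp only [Matrix.trace, Matrix.diag, Matrix.mul_apply, Complex.re_sum]
    refine Finset.sum_congr rfl fun i _ => Finset.sum_congr rfl fun j _ => ?_
    rw [← Complex.normSq_eq_norm_sq]
    simp [Complex.normSq_apply]
  conj_inner_symm u v := by
    rw [conj_trivial]
    have h : (uᴴ * v) = (vᴴ * u)ᴴ := by simp
    rw [h, Matrix.trace_conjTranspose]
    simp
  add_left u v w := by simp [Matrix.add_mul]
  smul_left u v r := by simp [Matrix.conjTranspose_smul]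

attribute [local instance] matrixInnerProductSpace

/-! ### The grid -/

/-- The vertices of the `d`-dimensional grid `I^d_N`: the integer points of `[0, N]^d`. -/
abbrev Vertex (d N : ℕ) : Type := Fin d → Fin (N + 1)

/-- The neighbour `v + e_i` of `v` in the positive direction of the `i`-th axis.
It is only used for vertices with `v i < N`. -/
def Vertex.shift {d N : ℕ} (v : Vertex d N) (i : Fin d) : Vertex d N :=
  Function.update v i (v i + 1)

/-- The edges of the grid, given by the minimal vertex `v` and the direction `i`. -/
abbrev Edge (d N : ℕ) : Type :=
  {p : Vertex d N × Fin d // (p.1 p.2 : ℕ) < N}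

/-- The starting (minimal) vertex of an edge. -/
def Edge.start {d N : ℕ} (e : Edge d N) : Vertex d N := e.1.1

/-- The ending (maximal) vertex of an edge. -/
def Edge.finish {d N : ℕ} (e : Edge d N) : Vertex d N := e.1.1.shift e.1.2

/-- The two-dimensional faces of the grid, given by the minimal vertex `v` and two directions
`i < j`. -/
abbrev Face (d N : ℕ) : Type :=
  {p : Vertex d N × Fin d × Fin d //
    p.2.1 < p.2.2 ∧ (p.1 p.2.1 : ℕ) < N ∧ (p.1 p.2.2 : ℕ) < N}

namespace Face

variable {d N : ℕ}

/-! The vertices of a face with minimal vertex `a` and directions `i < j` are denoted by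
`a`, `b = a + e_j`, `c = a + e_i + e_j`, `d = a + e_i`. This is the cyclic order of the positively
oriented boundary (vertices are ordered lexicographically, hence `b < d`). The edges of the face
are `ab`, `bc`, `ad`, `dc`. -/

/-- The edge from `a` to `a + e_j`. -/
def ab (f : Face d N) : Edge d N := ⟨(f.1.1, f.1.2.2), f.2.2.2⟩

/-- The edge from `a + e_j` to `a + e_i + e_j`. -/
def bc (f : Face d N) : Edge d N :=
  ⟨(f.1.1.shift f.1.2.2, f.1.2.1), by
    have h := f.2.2.1
    have hne : f.1.2.1 ≠ f.1.2.2 := ne_of_lt f.2.1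
    simpa [Vertex.shift, Function.update_of_ne hne] using h⟩

/-- The edge from `a` to `a + e_i`. -/
def ad (f : Face d N) : Edge d N := ⟨(f.1.1, f.1.2.1), f.2.2.1⟩

/-- The edge from `a + e_i` to `a + e_i + e_j`. -/
def dc (f : Face d N) : Edge d N :=
  ⟨(f.1.1.shift f.1.2.1, f.1.2.2), by
    have h := f.2.2.2
    have hne : f.1.2.2 ≠ f.1.2.1 := ne_of_gt f.2.1
    simpa [Vertex.shift, Function.update_of_ne hne] using h⟩

/-- The set of the four edges of a face. -/
def edges (f : Face d N) : Finset (Edge d N) := {f.ab, f.bc, f.ad, f.dc}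

/-- The face is parallel to the time axis `(1, 0, …, 0)`. -/
def IsTimelike (f : Face d N) : Prop := (f.1.2.1 : ℕ) = 0 ∨ (f.1.2.2 : ℕ) = 0

instance (f : Face d N) : Decidable f.IsTimelike :=
  inferInstanceAs (Decidable (_ ∨ _))

end Face

/-- The Minkowski sharp operator on functions on two-dimensional faces. -/
def sharp {d N : ℕ} {V : Type*} [Neg V] (Φ : Face d N → V) (f : Face d N) : V :=
  if f.IsTimelike then -Φ f else Φ f

/-! ### Parallel transport -/

/-- An edge path: the list of the consecutive edges, each with the sign `1` or `-1` according to
whether the edge is passed in its positive or in its negative direction. -/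
abbrev EdgePath (d N : ℕ) : Type := List (Edge d N × ℤˣ)

/-- The operator of parallel transport along an edge path: the ordered product of `U(e)^{±1}`. -/
def transport {d N : ℕ} {G : Type*} [Group G] (U : Edge d N → G) (π : EdgePath d N) : G :=
  (π.map fun s => U s.1 ^ (s.2 : ℤ)).prod

/-- The positively oriented boundary `∂f` of a face, starting at the minimal vertex. -/
def Face.boundary {d N : ℕ} (f : Face d N) : EdgePath d N :=
  [(f.ab, 1), (f.bc, 1), (f.dc, -1), (f.ad, -1)]

/-- The path `∂f - e` for an edge `e` of a face `f`: it starts at `min e`, consists of the three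
other edges of `f`, and ends at `max e`. (It is only used for edges `e` of `f`.) -/
def Face.detour {d N : ℕ} (f : Face d N) (e : Edge d N) : EdgePath d N :=
  if e = f.ab then [(f.ad, 1), (f.dc, 1), (f.bc, -1)]
  else if e = f.bc then [(f.ab, -1), (f.ad, 1), (f.dc, 1)]
  else if e = f.ad then [(f.ab, 1), (f.bc, 1), (f.dc, -1)]
  else [(f.ad, -1), (f.ab, 1), (f.bc, 1)]

/-! ### Gauge group fields

`G` is a Lie group with a unitary representation `ρ : G → U(n)`. A gauge group field is a map
`U : Edge d N → G`; the matrix on the edge `e` is `ρ (U e)`. A covariant current is a map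
`j : Edge d N → Matrix (Fin n) (Fin n) ℂ`. -/

section Gauge

variable {d N n : ℕ} {G : Type*} [Group G]

/-- The unitary matrix representing an element of the gauge group. -/
def repMatrix (ρ : G →* Matrix.unitaryGroup (Fin n) ℂ) (g : G) : Matrix (Fin n) (Fin n) ℂ :=
  (ρ g : Matrix (Fin n) (Fin n) ℂ)

/-- The action functional
`S[U] = ∑_f #(Re Tr U(∂f) - n) - ∑_e Re Tr [j^*(e) U(e)]`. -/
def action (ρ : G →* Matrix.unitaryGroup (Fin n) ℂ) (j : Edge d N → Matrix (Fin n) (Fin n) ℂ)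
    (U : Edge d N → G) : ℝ :=
  (∑ f : Face d N,
      sharp (fun f => (repMatrix ρ (transport U f.boundary)).trace.re - (n : ℝ)) f)
    - ∑ e : Edge d N, ((j e)ᴴ * repMatrix ρ (U e)).trace.re

/-- The covariant boundary of a matrix-valued function on edges:
`[D_A^* j](v) = ∑_{e ending at v} U(e)⁻¹ j(e) - ∑_{e starting at v} j(e) U(e)⁻¹`. -/
def covariantBoundary (ρ : G →* Matrix.unitaryGroup (Fin n) ℂ) (U : Edge d N → G)
    (j : Edge d N → Matrix (Fin n) (Fin n) ℂ) (v : Vertex d N) : Matrix (Fin n) (Fin n) ℂ :=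
  (∑ e : Edge d N with e.finish = v, (repMatrix ρ (U e))⁻¹ * j e)
    - ∑ e : Edge d N with e.start = v, j e * (repMatrix ρ (U e))⁻¹

/-- The covariant boundary of the sharp of the curvature:
`[D_A^* # F](e) = ∑_{f ⊃ e} #(U(e) - U(∂f - e))`. -/
def covariantBoundarySharpCurvature (ρ : G →* Matrix.unitaryGroup (Fin n) ℂ) (U : Edge d N → G)
    (e : Edge d N) : Matrix (Fin n) (Fin n) ℂ :=
  ∑ f : Face d N with e ∈ f.edges,
    sharp (fun f => repMatrix ρ (U e) - repMatrix ρ (transport U (f.detour e))) f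

variable [TopologicalSpace G]

/-- The representation is smooth, i.e. all its matrix entries are smooth functions on the Lie
group. -/
def IsSmoothRep (E : Type*) [NormedAddCommGroup E] [NormedSpace ℝ E] [ChartedSpace E G]
    (ρ : G →* Matrix.unitaryGroup (Fin n) ℂ) : Prop :=
  ∀ k l : Fin n, ContMDiff 𝓘(ℝ, E) 𝓘(ℝ, ℂ) ∞ (fun g : G => repMatrix ρ g k l)

/-- The differential of the representation at `g`, as a map from the tangent space of the Lie group
at `g` to matrices, computed entrywise. -/
def repDifferential (E : Type*) [NormedAddCommGroup E] [NormedSpace ℝ E] [ChartedSpace E G]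
    (ρ : G →* Matrix.unitaryGroup (Fin n) ℂ) (g : G) :
    TangentSpace 𝓘(ℝ, E) g →ₗ[ℝ] Matrix (Fin n) (Fin n) ℂ where
  toFun ξ := Matrix.of fun k l =>
    (mfderiv 𝓘(ℝ, E) 𝓘(ℝ, ℂ) (fun h : G => repMatrix ρ h k l) g ξ : ℂ)
  map_add' ξ η := by
    ext k l
    exact (mfderiv 𝓘(ℝ, E) 𝓘(ℝ, ℂ) (fun h : G => repMatrix ρ h k l) g).map_add ξ η
  map_smul' r ξ := by
    ext k l
    exact (mfderiv 𝓘(ℝ, E) 𝓘(ℝ, ℂ) (fun h : G => repMatrix ρ h k l) g).map_smul r ξ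

/-- The linear subspace `T_g G` of the space of matrices parallel to the tangent space
to the (represented) group at the point `g`: the range of the differential of `ρ` at `g`. -/
def tangent (E : Type*) [NormedAddCommGroup E] [NormedSpace ℝ E] [ChartedSpace E G]
    (ρ : G →* Matrix.unitaryGroup (Fin n) ℂ) (g : G) :
    Submodule ℝ (Matrix (Fin n) (Fin n) ℂ) :=
  LinearMap.range (repDifferential E ρ g)

/-- The function `Pr_{T_U G} j` on edges: the orthogonal projection of `j(e)` to `T_{U(e)} G`
with respect to the scalar product `Re Tr (u^* v)`. -/
def projTangent (E : Type*) [NormedAddCommGroup E] [NormedSpace ℝ E] [ChartedSpace E G]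
    (ρ : G →* Matrix.unitaryGroup (Fin n) ℂ) (U : Edge d N → G)
    (j : Edge d N → Matrix (Fin n) (Fin n) ℂ) (e : Edge d N) : Matrix (Fin n) (Fin n) ℂ :=
  (tangent E ρ (U e)).starProjection (j e)

/-- The gauge group field `U` is generated by the covariant current `j`: it is a stationary point
of the action for fixed `j` under variations with values in `G`, i.e. the derivative at `t = 0` of
the action vanishes along every family `γ t` of gauge group fields with `γ 0 = U` that is
differentiable at `t = 0`. -/
def IsGeneratedBy (E : Type*) [NormedAddCommGroup E] [NormedSpace ℝ E] [ChartedSpace E G]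
    (ρ : G →* Matrix.unitaryGroup (Fin n) ℂ) (U : Edge d N → G)
    (j : Edge d N → Matrix (Fin n) (Fin n) ℂ) : Prop :=
  ∀ γ : ℝ → Edge d N → G, γ 0 = U →
    (∀ e, MDifferentiableAt 𝓘(ℝ, ℝ) 𝓘(ℝ, E) (fun t => γ t e) 0) →
    HasDerivAt (fun t => action ρ j (γ t)) 0 0

end Gauge

end LatticeGauge

end

/-! Both claims test the stationarity of the action on well-chosen curves of fields;
`mem_tangent_iff` identifies `T_gG` with the velocities of represented curves through `g`.

Yang–Mills: vary `U` on one edge `e` only. For a face `f ⊃ e`, `Re Tr U(∂f) = ⟨U(∂f - e), U(e)⟩`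
(`re_trace_boundary`), and the detour `∂f - e` avoids `e`, so the action is affine in the matrix on
`e`. Stationarity makes `∑ #U(∂f - e) - j(e)` orthogonal to `T_{U(e)}G`. The remaining part of
`D_A^*#F` is a real multiple of `U(e)`, itself orthogonal to `T_{U(e)}G` by unitarity.

Charge conservation is Noether's argument, independent of the field equation. A gauge transformation
conjugates face holonomies, so only the current term of the action varies. Transform at a single
vertex `v` along a curve with velocity `D = [D_A^* Pr j](v)`, which lies in `T_1G`. The derivative
of the action is then `⟨D, D⟩`, hence `D = 0`. -/

namespace LatticeGauge

attribute [local instance] Matrix.frobeniusNormedAddCommGroup Matrix.frobeniusNormedSpace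
attribute [local instance] matrixInnerProductSpace

/-! ### Entrywise derivatives of matrix-valued curves -/

/-- The matrix-valued curve `M` has the entrywise derivative `X` at time `0`. -/
def HasEntryDeriv {n : ℕ} (M : ℝ → Matrix (Fin n) (Fin n) ℂ) (X : Matrix (Fin n) (Fin n) ℂ) :
    Prop :=
  ∀ k l, HasDerivAt (fun t => M t k l) (X k l) 0

namespace HasEntryDeriv

variable {n : ℕ} {M : ℝ → Matrix (Fin n) (Fin n) ℂ} {X : Matrix (Fin n) (Fin n) ℂ}

theorem const (A : Matrix (Fin n) (Fin n) ℂ) : HasEntryDeriv (fun _ => A) 0 :=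
  fun k l => hasDerivAt_const (0 : ℝ) (A k l)

theorem unique {Y : Matrix (Fin n) (Fin n) ℂ} (h : HasEntryDeriv M X) (h' : HasEntryDeriv M Y) :
    X = Y := by
  ext k l
  exact (h k l).unique (h' k l)

theorem mul {M' : ℝ → Matrix (Fin n) (Fin n) ℂ} {Y : Matrix (Fin n) (Fin n) ℂ}
    (h : HasEntryDeriv M X) (h' : HasEntryDeriv M' Y) :
    HasEntryDeriv (fun t => M t * M' t) (X * M' 0 + M 0 * Y) := by
  intro k l
  simp only [Matrix.mul_apply, Matrix.add_apply, ← Finset.sum_add_distrib]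
  exact HasDerivAt.fun_sum fun i _ => (h k i).mul (h' i l)

theorem const_mul (A : Matrix (Fin n) (Fin n) ℂ) (h : HasEntryDeriv M X) :
    HasEntryDeriv (fun t => A * M t) (A * X) := by
  simpa using (HasEntryDeriv.const A).mul h

theorem mul_const (h : HasEntryDeriv M X) (A : Matrix (Fin n) (Fin n) ℂ) :
    HasEntryDeriv (fun t => M t * A) (X * A) := by
  simpa using h.mul (HasEntryDeriv.const A)

theorem conjTranspose (h : HasEntryDeriv M X) : HasEntryDeriv (fun t => (M t)ᴴ) Xᴴ :=
  fun k l => (h l k).star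

theorem re_trace (h : HasEntryDeriv M X) :
    HasDerivAt (fun t => (M t).trace.re) X.trace.re 0 := by
  simp only [Matrix.trace, Matrix.diag, Complex.re_sum]
  refine HasDerivAt.fun_sum fun i _ => ?_
  exact Complex.reCLM.hasFDerivAt.comp_hasDerivAt (0 : ℝ) (h i i)

end HasEntryDeriv

/-! ### The representation -/

section Representation

variable {n : ℕ} {G : Type*} [Group G] (ρ : G →* Matrix.unitaryGroup (Fin n) ℂ)

@[simp]
theorem repMatrix_one : repMatrix ρ 1 = 1 := by
  simp [repMatrix]

theorem repMatrix_mul (g h : G) : repMatrix ρ (g * h) = repMatrix ρ g * repMatrix ρ h := by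
  simp [repMatrix]

theorem repMatrix_inv (g : G) : repMatrix ρ g⁻¹ = (repMatrix ρ g)ᴴ := by
  simp [repMatrix, Matrix.star_eq_conjTranspose]

theorem inv_repMatrix (g : G) : (repMatrix ρ g)⁻¹ = repMatrix ρ g⁻¹ :=
  Matrix.inv_eq_left_inv (by rw [← repMatrix_mul, inv_mul_cancel, repMatrix_one])

/-- By unitarity the inverse is the adjoint, whose trace is the complex conjugate. Hence the
orientation of a face does not affect the action. -/
theorem re_trace_repMatrix_inv (g : G) :
    (repMatrix ρ g⁻¹).trace.re = (repMatrix ρ g).trace.re := by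
  rw [repMatrix_inv, Matrix.trace_conjTranspose]
  simp

theorem re_trace_repMatrix_conj (g h : G) :
    (repMatrix ρ (g * h * g⁻¹)).trace.re = (repMatrix ρ h).trace.re := by
  rw [repMatrix_mul, Matrix.trace_mul_comm, ← repMatrix_mul]
  simp

theorem inner_repMatrix (g h : G) :
    inner ℝ (repMatrix ρ g) (repMatrix ρ h) = (repMatrix ρ (g⁻¹ * h)).trace.re := by
  rw [repMatrix_mul, repMatrix_inv]
  rfl

end Representation

theorem matrix_inner_def {n : ℕ} (A B : Matrix (Fin n) (Fin n) ℂ) :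
    inner ℝ A B = (Aᴴ * B).trace.re := rfl

theorem HasEntryDeriv.inner {n : ℕ} {M : ℝ → Matrix (Fin n) (Fin n) ℂ}
    {X : Matrix (Fin n) (Fin n) ℂ} (h : HasEntryDeriv M X) (A : Matrix (Fin n) (Fin n) ℂ) :
    HasDerivAt (fun t => inner ℝ A (M t)) (inner ℝ A X) 0 :=
  (h.const_mul Aᴴ).re_trace

/-- Differentiate `c^* c = 1` at the identity. This gives the velocity of the inverse curve, which
is represented by the adjoint. -/
theorem HasEntryDeriv.conjTranspose_eq_neg
    {n : ℕ} {G : Type*} [Group G] {ρ : G →* Matrix.unitaryGroup (Fin n) ℂ}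
    {c : ℝ → G} (hc0 : c 0 = 1) {X : Matrix (Fin n) (Fin n) ℂ}
    (hX : HasEntryDeriv (fun t => repMatrix ρ (c t)) X) : Xᴴ = -X := by
  have h := hX.conjTranspose.mul hX
  have h1 : ∀ t, (repMatrix ρ (c t))ᴴ * repMatrix ρ (c t) = 1 := fun t => by
    rw [← repMatrix_inv, ← repMatrix_mul, inv_mul_cancel, repMatrix_one]
  simp only [h1] at h
  have h2 := h.unique (HasEntryDeriv.const 1)
  simp only [hc0, repMatrix_one, Matrix.conjTranspose_one, mul_one, one_mul] at h2
  exact eq_neg_of_add_eq_zero_left h2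

/-! ### Tangent spaces and curves -/

/-- A manifold without boundary has a curve through each point with each velocity. -/
theorem exists_curve_mfderiv_eq {E : Type*} [NormedAddCommGroup E] [NormedSpace ℝ E]
    {G : Type*} [TopologicalSpace G] [ChartedSpace E G] [IsManifold 𝓘(ℝ, E) ∞ G]
    (g : G) (ξ : E) :
    ∃ c : ℝ → G, c 0 = g ∧ MDifferentiableAt 𝓘(ℝ, ℝ) 𝓘(ℝ, E) c 0 ∧
      mfderiv 𝓘(ℝ, ℝ) 𝓘(ℝ, E) c 0 (1 : ℝ) = ξ := by
  set φ := extChartAt 𝓘(ℝ, E) g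
  -- The curve is a straight line in the chart at `g`, pulled back to the group.
  let ℓ : ℝ → E := fun t => φ g + t • ξ
  have hℓ0 : ℓ 0 = φ g := by simp [ℓ]
  have hℓ : HasFDerivAt ℓ (ContinuousLinearMap.toSpanSingleton ℝ ξ) 0 := by
    have h := ((hasDerivAt_id (0 : ℝ)).smul_const ξ).const_add (φ g)
    simpa [ℓ] using h.hasFDerivAt
  have hφ : HasMFDerivAt 𝓘(ℝ, E) 𝓘(ℝ, E) φ.symm (ℓ 0)
      (mfderiv 𝓘(ℝ, E) 𝓘(ℝ, E) φ.symm (ℓ 0)) := by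
    refine MDifferentiableAt.hasMFDerivAt ?_
    rw [hℓ0]
    have h := mdifferentiableWithinAt_extChartAt_symm (I := 𝓘(ℝ, E)) (x := g)
      (mem_extChartAt_target g)
    rwa [modelWithCornersSelf_coe, Set.range_id, mdifferentiableWithinAt_univ] at h
  have hc := hφ.comp (0 : ℝ) hℓ.hasMFDerivAt
  refine ⟨φ.symm ∘ ℓ, by simp [hℓ0, φ], hc.mdifferentiableAt, ?_⟩
  rw [hc.mfderiv]
  -- Tangent vectors at `g` are expressed in the preferred chart at `g`, so the inverse of that
  -- chart has identity derivative at the base point.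
  have hid : mfderiv 𝓘(ℝ, E) 𝓘(ℝ, E) φ.symm (ℓ 0) = ContinuousLinearMap.id ℝ E := by
    rw [hℓ0]
    have h := mfderivWithin_range_extChartAt_symm (I := 𝓘(ℝ, E)) (x := g)
    rwa [modelWithCornersSelf_coe, Set.range_id, mfderivWithin_univ] at h
  rw [hid]
  exact one_smul ℝ ξ

section Tangent

variable {n : ℕ} {E : Type*} [NormedAddCommGroup E] [NormedSpace ℝ E]
  {G : Type*} [Group G] [TopologicalSpace G] [ChartedSpace E G]
  {ρ : G →* Matrix.unitaryGroup (Fin n) ℂ}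

theorem entryDeriv_repMatrix (hρ : IsSmoothRep E ρ) {c : ℝ → G}
    (hc : MDifferentiableAt 𝓘(ℝ, ℝ) 𝓘(ℝ, E) c 0) :
    HasEntryDeriv (fun t => repMatrix ρ (c t))
      (repDifferential E ρ (c 0) (mfderiv 𝓘(ℝ, ℝ) 𝓘(ℝ, E) c 0 (1 : ℝ))) := by
  intro k l
  have h := ((hρ k l).mdifferentiable (by simp) (c 0)).hasMFDerivAt.comp (0 : ℝ) hc.hasMFDerivAt
  have h' : HasFDerivAt (fun t => repMatrix ρ (c t) k l) (_ : ℝ →L[ℝ] ℂ) 0 :=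
    hasMFDerivAt_iff_hasFDerivAt.1 h
  exact h'.hasDerivAt

/-- The tangent space consists of the velocities of the represented curves. -/
theorem mem_tangent_iff [IsManifold 𝓘(ℝ, E) ∞ G] (hρ : IsSmoothRep E ρ) {g : G}
    {X : Matrix (Fin n) (Fin n) ℂ} :
    X ∈ tangent E ρ g ↔ ∃ c : ℝ → G, c 0 = g ∧ MDifferentiableAt 𝓘(ℝ, ℝ) 𝓘(ℝ, E) c 0 ∧
      HasEntryDeriv (fun t => repMatrix ρ (c t)) X := by
  constructor
  · rintro ⟨ξ, rfl⟩
    obtain ⟨c, hc0, hc, hξ⟩ := exists_curve_mfderiv_eq (E := E) g ξ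
    subst hc0
    refine ⟨c, rfl, hc, ?_⟩
    rw [← hξ]
    exact entryDeriv_repMatrix hρ hc
  · rintro ⟨c, rfl, hc, hX⟩
    exact ⟨_, (entryDeriv_repMatrix hρ hc).unique hX⟩

variable [LieGroup 𝓘(ℝ, E) ∞ G]

theorem mdifferentiableAt_mul_left {c : ℝ → G} (g : G)
    (hc : MDifferentiableAt 𝓘(ℝ, ℝ) 𝓘(ℝ, E) c 0) :
    MDifferentiableAt 𝓘(ℝ, ℝ) 𝓘(ℝ, E) (fun t => g * c t) 0 :=
  ((contMDiff_mul_left (I := 𝓘(ℝ, E)) (n := ∞) (a := g)).mdifferentiable (by simp)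
    (c 0)).comp (0 : ℝ) hc

theorem mdifferentiableAt_mul_right {c : ℝ → G} (g : G)
    (hc : MDifferentiableAt 𝓘(ℝ, ℝ) 𝓘(ℝ, E) c 0) :
    MDifferentiableAt 𝓘(ℝ, ℝ) 𝓘(ℝ, E) (fun t => c t * g) 0 :=
  ((contMDiff_mul_right (I := 𝓘(ℝ, E)) (n := ∞) (a := g)).mdifferentiable (by simp)
    (c 0)).comp (0 : ℝ) hc

theorem mdifferentiableAt_inv {c : ℝ → G} (hc : MDifferentiableAt 𝓘(ℝ, ℝ) 𝓘(ℝ, E) c 0) :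
    MDifferentiableAt 𝓘(ℝ, ℝ) 𝓘(ℝ, E) (fun t => (c t)⁻¹) 0 :=
  ((contMDiff_inv 𝓘(ℝ, E) ∞ (G := G)).mdifferentiable (by simp) (c 0)).comp (0 : ℝ) hc

theorem repMatrix_mul_mem_tangent (hρ : IsSmoothRep E ρ) {g : G} {X : Matrix (Fin n) (Fin n) ℂ}
    (h : G) (hX : X ∈ tangent E ρ g) : repMatrix ρ h * X ∈ tangent E ρ (h * g) := by
  obtain ⟨c, rfl, hc, hX⟩ := (mem_tangent_iff hρ).1 hX
  refine (mem_tangent_iff hρ).2 ⟨_, rfl, mdifferentiableAt_mul_left h hc, ?_⟩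
  simpa only [repMatrix_mul] using hX.const_mul (repMatrix ρ h)

theorem mul_repMatrix_mem_tangent (hρ : IsSmoothRep E ρ) {g : G} {X : Matrix (Fin n) (Fin n) ℂ}
    (h : G) (hX : X ∈ tangent E ρ g) : X * repMatrix ρ h ∈ tangent E ρ (g * h) := by
  obtain ⟨c, rfl, hc, hX⟩ := (mem_tangent_iff hρ).1 hX
  refine (mem_tangent_iff hρ).2 ⟨_, rfl, mdifferentiableAt_mul_right h hc, ?_⟩
  simpa only [repMatrix_mul] using hX.mul_const (repMatrix ρ h)

/-- A unitary matrix is orthogonal to the tangent space of the unitary group at it. -/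
theorem inner_repMatrix_tangent (hρ : IsSmoothRep E ρ) {g : G} {X : Matrix (Fin n) (Fin n) ℂ}
    (hX : X ∈ tangent E ρ g) : inner ℝ (repMatrix ρ g) X = 0 := by
  obtain ⟨c, rfl, hc, hX⟩ := (mem_tangent_iff hρ).1 hX
  -- Differentiating the constant `Re Tr (U^* U)` yields twice the scalar product in question.
  have h := (hX.conjTranspose.mul hX).re_trace
  have h1 : ∀ t, (repMatrix ρ (c t))ᴴ * repMatrix ρ (c t) = 1 := fun t => by
    rw [← repMatrix_inv, ← repMatrix_mul, inv_mul_cancel, repMatrix_one]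
  simp only [h1] at h
  have h2 := h.unique (hasDerivAt_const (0 : ℝ) _)
  have h3 : (Xᴴ * repMatrix ρ (c 0)).trace.re = inner ℝ (repMatrix ρ (c 0)) X := by
    rw [real_inner_comm]; rfl
  rw [Matrix.trace_add, Complex.add_re, h3, ← matrix_inner_def] at h2
  linarith

end Tangent

/-! ### Combinatorics of the grid -/

section Grid

variable {d N : ℕ}

theorem Vertex.shift_ne_self {v : Vertex d N} {i : Fin d} (h : (v i : ℕ) < N) : v.shift i ≠ v := by
  intro hv
  have h1 : v i + 1 = v i := by simpa [Vertex.shift] using congrFun hv i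
  have h2 := congrArg Fin.val h1
  -- Addition in `Fin (N + 1)` is cyclic; the bound `v i < N` excludes wrap-around.
  rw [Fin.val_add_one_of_lt (Fin.lt_def.2 (by simpa using h))] at h2
  omega

theorem Edge.finish_ne_start (e : Edge d N) : e.finish ≠ e.start :=
  Vertex.shift_ne_self e.2

theorem Vertex.shift_comm {v : Vertex d N} {i k : Fin d} (h : i ≠ k) :
    (v.shift i).shift k = (v.shift k).shift i := by
  simp only [Vertex.shift, Function.update_of_ne h, Function.update_of_ne h.symm]
  exact Function.update_comm h _ _ _

namespace Face

variable (f : Face d N)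

theorem ab_ne_bc : f.ab ≠ f.bc := fun h =>
  f.2.1.ne' (congrArg (fun e : Edge d N => e.1.2) h)

theorem ab_ne_ad : f.ab ≠ f.ad := fun h =>
  f.2.1.ne' (congrArg (fun e : Edge d N => e.1.2) h)

theorem bc_ne_dc : f.bc ≠ f.dc := fun h =>
  f.2.1.ne (congrArg (fun e : Edge d N => e.1.2) h)

theorem ad_ne_dc : f.ad ≠ f.dc := fun h =>
  f.2.1.ne (congrArg (fun e : Edge d N => e.1.2) h)

theorem ab_ne_dc : f.ab ≠ f.dc := fun h =>
  Vertex.shift_ne_self f.2.2.1 (congrArg (fun e : Edge d N => e.1.1) h).symm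

theorem bc_ne_ad : f.bc ≠ f.ad := fun h =>
  Vertex.shift_ne_self f.2.2.2 (congrArg (fun e : Edge d N => e.1.1) h)

theorem bc_finish : f.bc.finish = f.dc.finish :=
  Vertex.shift_comm f.2.1.ne'

theorem mem_edges {e : Edge d N} :
    e ∈ f.edges ↔ e = f.ab ∨ e = f.bc ∨ e = f.ad ∨ e = f.dc := by
  simp [edges]

theorem detour_ab : f.detour f.ab = [(f.ad, 1), (f.dc, 1), (f.bc, -1)] := if_pos rfl

theorem detour_bc : f.detour f.bc = [(f.ab, -1), (f.ad, 1), (f.dc, 1)] := by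
  rw [detour, if_neg f.ab_ne_bc.symm, if_pos rfl]

theorem detour_ad : f.detour f.ad = [(f.ab, 1), (f.bc, 1), (f.dc, -1)] := by
  rw [detour, if_neg f.ab_ne_ad.symm, if_neg f.bc_ne_ad.symm, if_pos rfl]

theorem detour_dc : f.detour f.dc = [(f.ad, -1), (f.ab, 1), (f.bc, 1)] := by
  rw [detour, if_neg f.ab_ne_dc.symm, if_neg f.bc_ne_dc.symm, if_neg f.ad_ne_dc.symm]

/-- The detour around an edge does not contain this edge. -/
theorem ne_of_mem_detour {e : Edge d N} (he : e ∈ f.edges) {s : Edge d N × ℤˣ}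
    (hs : s ∈ f.detour e) : s.1 ≠ e := by
  have h1 := f.ab_ne_bc
  have h2 := f.ab_ne_ad
  have h3 := f.ab_ne_dc
  have h4 := f.bc_ne_ad
  have h5 := f.bc_ne_dc
  have h6 := f.ad_ne_dc
  rcases f.mem_edges.1 he with rfl | rfl | rfl | rfl <;>
    simp only [detour_ab, detour_bc, detour_ad, detour_dc, List.mem_cons, List.not_mem_nil,
      or_false] at hs <;>
    rcases hs with rfl | rfl | rfl <;> first | assumption | (symm; assumption)

theorem mem_edges_of_mem_boundary {s : Edge d N × ℤˣ} (hs : s ∈ f.boundary) :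
    s.1 ∈ f.edges := by
  simp only [boundary, List.mem_cons, List.not_mem_nil, or_false] at hs
  rcases hs with rfl | rfl | rfl | rfl <;> simp [edges]

end Face

/-- The sign in the definition of the sharp operator. -/
def Face.sharpSign (f : Face d N) : ℝ := if f.IsTimelike then -1 else 1

theorem sharp_eq_smul {V : Type*} [AddCommGroup V] [Module ℝ V] (Φ : Face d N → V)
    (f : Face d N) : sharp Φ f = f.sharpSign • Φ f := by
  unfold sharp Face.sharpSign
  split_ifs <;> simp

end Grid

/-! ### Parallel transport along faces -/

section Transport

variable {d N n : ℕ} {G : Type*} [Group G]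

theorem transport_congr {U V : Edge d N → G} {π : EdgePath d N} (h : ∀ s ∈ π, U s.1 = V s.1) :
    transport U π = transport V π := by
  unfold transport
  congr 1
  exact List.map_congr_left fun s hs => by rw [h s hs]

theorem transport_boundary (U : Edge d N → G) (f : Face d N) :
    transport U f.boundary = U f.ab * U f.bc * (U f.dc)⁻¹ * (U f.ad)⁻¹ := by
  simp [transport, Face.boundary, mul_assoc]

/-- The trace of the holonomy of a face in terms of one of its edges and the detour around it. -/
theorem re_trace_boundary (ρ : G →* Matrix.unitaryGroup (Fin n) ℂ) (U : Edge d N → G)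
    (f : Face d N) {e : Edge d N} (he : e ∈ f.edges) :
    (repMatrix ρ (transport U f.boundary)).trace.re =
      inner ℝ (repMatrix ρ (transport U (f.detour e))) (repMatrix ρ (U e)) := by
  rw [inner_repMatrix, transport_boundary]
  rcases f.mem_edges.1 he with rfl | rfl | rfl | rfl
  -- Conjugation rotates the closed path cyclically until it reads `(∂f - e)⁻¹ e`.
  · rw [← re_trace_repMatrix_conj ρ (U f.ab)⁻¹]
    simp [transport, Face.detour_ab, mul_assoc]
  · rw [← re_trace_repMatrix_conj ρ (U f.ab * U f.bc)⁻¹]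
    simp [transport, Face.detour_bc, mul_assoc]
  -- The boundary passes `ad` and `dc` backwards, so the loop is inverted before it is rotated.
  · rw [← re_trace_repMatrix_inv, ← re_trace_repMatrix_conj ρ (U f.ad)⁻¹]
    simp [transport, Face.detour_ad, mul_assoc]
  · rw [← re_trace_repMatrix_inv, ← re_trace_repMatrix_conj ρ (U f.ad * U f.dc)⁻¹]
    simp [transport, Face.detour_dc, mul_assoc]

theorem action_eq (ρ : G →* Matrix.unitaryGroup (Fin n) ℂ)
    (j : Edge d N → Matrix (Fin n) (Fin n) ℂ) (U : Edge d N → G) :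
    action ρ j U =
      (∑ f : Face d N, f.sharpSign * ((repMatrix ρ (transport U f.boundary)).trace.re - n))
        - ∑ e : Edge d N, inner ℝ (j e) (repMatrix ρ (U e)) := by
  simp only [action, sharp_eq_smul, smul_eq_mul, matrix_inner_def]

/-- The gauge transformation of a gauge group field by a function on vertices. -/
def gaugeTransform (h : Vertex d N → G) (U : Edge d N → G) (e : Edge d N) : G :=
  h e.start * U e * (h e.finish)⁻¹

/-- The factors of `h` at intermediate vertices cancel along the closed path; only those at its base
point survive. -/
theorem transport_gaugeTransform_boundary (h : Vertex d N → G) (U : Edge d N → G)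
    (f : Face d N) : transport (gaugeTransform h U) f.boundary =
      h f.1.1 * transport U f.boundary * (h f.1.1)⁻¹ := by
  have h1 : f.ab.finish = f.bc.start := rfl
  have h2 : f.ad.finish = f.dc.start := rfl
  have h3 : f.ab.start = f.1.1 := rfl
  have h4 : f.ad.start = f.1.1 := rfl
  simp only [transport_boundary, gaugeTransform, f.bc_finish, h1, h2, h3, h4]
  group

end Transport

/-! ### Variations of the action -/

section Variation

variable {d N n : ℕ} {G : Type*} [Group G] {ρ : G →* Matrix.unitaryGroup (Fin n) ℂ}
  {j : Edge d N → Matrix (Fin n) (Fin n) ℂ} {U : Edge d N → G}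

/-- The derivative of the action under a variation of the field on a single edge. -/
theorem hasDerivAt_action_update (e : Edge d N) {c : ℝ → G} {X : Matrix (Fin n) (Fin n) ℂ}
    (hX : HasEntryDeriv (fun t => repMatrix ρ (c t)) X) :
    HasDerivAt (fun t => action ρ j (Function.update U e (c t)))
      (inner ℝ ((∑ f : Face d N with e ∈ f.edges,
        f.sharpSign • repMatrix ρ (transport U (f.detour e))) - j e) X) 0 := by
  simp only [action_eq, inner_sub_left, sum_inner, Finset.sum_filter]
  refine HasDerivAt.sub (HasDerivAt.fun_sum fun f _ => ?_) ?_
  · split_ifs with he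
    · have h : ∀ t, (repMatrix ρ (transport (Function.update U e (c t)) f.boundary)).trace.re =
          inner ℝ (repMatrix ρ (transport U (f.detour e))) (repMatrix ρ (c t)) := fun t => by
        have ht : transport (Function.update U e (c t)) (f.detour e) = transport U (f.detour e) :=
          transport_congr fun s hs => by
            rw [Function.update_of_ne (f.ne_of_mem_detour he hs)]
        rw [re_trace_boundary ρ _ f he, Function.update_self, ht]
      simp only [h, real_inner_smul_left]
      exact ((hX.inner _).sub_const _).const_mul _
    · have h : ∀ t, transport (Function.update U e (c t)) f.boundary = transport U f.boundary :=
        fun t => transport_congr fun s hs => by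
          have hse : s.1 ≠ e := fun hse => he (hse ▸ f.mem_edges_of_mem_boundary hs)
          rw [Function.update_of_ne hse]
      simp only [h, inner_zero_left]
      exact hasDerivAt_const _ _
  -- Only the edge `e` contributes, so the derivative is spread into a sum supported at `e` to match
  -- termwise.
  · have h : inner ℝ (j e) X = ∑ e', if e' = e then inner ℝ (j e) X else 0 := by simp
    rw [h]
    refine HasDerivAt.fun_sum fun e' _ => ?_
    split_ifs with he
    · subst he
      simpa using hX.inner (j e')
    · simpa [Function.update_of_ne he] using hasDerivAt_const (0 : ℝ) _

/-- The derivative of the action under an infinitesimal gauge transformation. -/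
theorem hasDerivAt_action_gaugeTransform {h : ℝ → Vertex d N → G}
    {K : Edge d N → Matrix (Fin n) (Fin n) ℂ}
    (hK : ∀ e, HasEntryDeriv (fun t => repMatrix ρ (gaugeTransform (h t) U e)) (K e)) :
    HasDerivAt (fun t => action ρ j (gaugeTransform (h t) U)) (-∑ e, inner ℝ (j e) (K e)) 0 := by
  simp only [action_eq, transport_gaugeTransform_boundary, re_trace_repMatrix_conj]
  exact (HasDerivAt.fun_sum fun e _ => (hK e).inner (j e)).const_sub _

/-- The pairing of the covariant boundary at a vertex with a matrix, summed over all edges. -/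
theorem inner_covariantBoundary (k : Edge d N → Matrix (Fin n) (Fin n) ℂ) (v : Vertex d N)
    (X : Matrix (Fin n) (Fin n) ℂ) :
    inner ℝ (covariantBoundary ρ U k v) X =
      -∑ e, inner ℝ (k e) (if e.start = v then X * repMatrix ρ (U e)
        else if e.finish = v then -(repMatrix ρ (U e) * X) else 0) := by
  simp only [covariantBoundary, inner_sub_left, sum_inner, Finset.sum_filter,
    ← Finset.sum_sub_distrib, ← Finset.sum_neg_distrib]
  refine Finset.sum_congr rfl fun e _ => ?_
  by_cases hs : e.start = v
  · have hf : e.finish ≠ v := fun hf => e.finish_ne_start (hf.trans hs.symm)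
    simp only [hs, hf, if_true, if_false, inner_zero_left, zero_sub, neg_inj, matrix_inner_def, inv_repMatrix,
      Matrix.conjTranspose_mul, repMatrix_inv, Matrix.conjTranspose_conjTranspose]
    rw [Matrix.mul_assoc, Matrix.trace_mul_comm, Matrix.mul_assoc]
  · by_cases hf : e.finish = v
    · simp only [hs, hf, if_true, if_false, inner_zero_left, sub_zero, inner_neg_right, neg_neg, matrix_inner_def,
        inv_repMatrix, Matrix.conjTranspose_mul, repMatrix_inv,
        Matrix.conjTranspose_conjTranspose, Matrix.mul_assoc]
    · simp [hs, hf]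

end Variation

/-! ### The projection to the tangent space -/

section Projection

variable {d N n : ℕ} {E : Type*} [NormedAddCommGroup E] [NormedSpace ℝ E]
  {G : Type*} [Group G] [TopologicalSpace G] [ChartedSpace E G]
  {ρ : G →* Matrix.unitaryGroup (Fin n) ℂ} {j : Edge d N → Matrix (Fin n) (Fin n) ℂ}
  {U : Edge d N → G}

theorem projTangent_mem (e : Edge d N) : projTangent E ρ U j e ∈ tangent E ρ (U e) :=
  Submodule.starProjection_apply_mem _ _

theorem inner_projTangent (e : Edge d N) {X : Matrix (Fin n) (Fin n) ℂ}
    (hX : X ∈ tangent E ρ (U e)) : inner ℝ (projTangent E ρ U j e) X = inner ℝ (j e) X := by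
  have h := Submodule.starProjection_inner_eq_zero (K := tangent E ρ (U e)) (j e) X hX
  rw [inner_sub_left] at h
  exact (sub_eq_zero.1 h).symm

end Projection

/-! ### The field equation and the conservation law -/

section Equations

variable {d N n : ℕ} {E : Type*} [NormedAddCommGroup E] [NormedSpace ℝ E]
  {G : Type*} [Group G] [TopologicalSpace G] [ChartedSpace E G] [LieGroup 𝓘(ℝ, E) ∞ G]
  {ρ : G →* Matrix.unitaryGroup (Fin n) ℂ} {j : Edge d N → Matrix (Fin n) (Fin n) ℂ}
  {U : Edge d N → G}

theorem inner_eq_zero_of_isGeneratedBy (hρ : IsSmoothRep E ρ) (hU : IsGeneratedBy E ρ U j)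
    (e : Edge d N) {X : Matrix (Fin n) (Fin n) ℂ} (hX : X ∈ tangent E ρ (U e)) :
    inner ℝ (covariantBoundarySharpCurvature ρ U e + j e) X = 0 := by
  obtain ⟨c, hc0, hc, hcX⟩ := (mem_tangent_iff hρ).1 hX
  have h0 := hU (fun t => Function.update U e (c t)) (by simp [hc0]) fun e' => by
    by_cases he : e' = e
    · subst he
      simpa using hc
    · simpa [Function.update_of_ne he] using mdifferentiableAt_const
  have h1 := h0.unique (hasDerivAt_action_update e hcX)
  -- The `U(e)` terms of all faces collect into one real multiple of `U(e)`, which is normal to the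
  -- tangent space; the rest is minus the gradient of the one-edge variation.
  have h2 : covariantBoundarySharpCurvature ρ U e + j e =
      (∑ f : Face d N with e ∈ f.edges, f.sharpSign) • repMatrix ρ (U e) -
      ((∑ f : Face d N with e ∈ f.edges,
        f.sharpSign • repMatrix ρ (transport U (f.detour e))) - j e) := by
    simp only [covariantBoundarySharpCurvature, sharp_eq_smul, smul_sub, Finset.sum_sub_distrib,
      Finset.sum_smul]
    abel
  rw [h2, inner_sub_left, ← h1, real_inner_smul_left, inner_repMatrix_tangent hρ hX]
  simp

/-- The discrete Yang–Mills equation. -/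
theorem yangMills_of_isGeneratedBy (hρ : IsSmoothRep E ρ) (hU : IsGeneratedBy E ρ U j) :
    -projTangent E ρ U (covariantBoundarySharpCurvature ρ U) = projTangent E ρ U j := by
  funext e
  have h : (tangent E ρ (U e)).starProjection (covariantBoundarySharpCurvature ρ U e + j e) = 0 := by
    rw [Submodule.starProjection_apply_eq_zero_iff, Submodule.mem_orthogonal']
    exact fun X hX => inner_eq_zero_of_isGeneratedBy hρ hU e hX
  rw [map_add] at h
  exact neg_eq_of_add_eq_zero_right h

/-- Translation by `U(e)⁻¹` on either side carries `T_{U(e)}G` to `T_1G`. This makes the boundary of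
the projected current an admissible gauge direction. -/
theorem covariantBoundary_projTangent_mem (hρ : IsSmoothRep E ρ) (v : Vertex d N) :
    covariantBoundary ρ U (projTangent E ρ U j) v ∈ tangent E ρ 1 := by
  refine Submodule.sub_mem _ (Submodule.sum_mem _ fun e _ => ?_) (Submodule.sum_mem _ fun e _ => ?_)
  · have h := repMatrix_mul_mem_tangent hρ (U e)⁻¹ (projTangent_mem (j := j) (U := U) e)
    rwa [inv_mul_cancel, ← inv_repMatrix] at h
  · have h := mul_repMatrix_mem_tangent hρ (U e)⁻¹ (projTangent_mem (j := j) (U := U) e)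
    rwa [mul_inv_cancel, ← inv_repMatrix] at h

/-- The charge conservation law. -/
theorem covariantBoundary_projTangent_eq_zero (hρ : IsSmoothRep E ρ)
    (hU : IsGeneratedBy E ρ U j) : covariantBoundary ρ U (projTangent E ρ U j) = 0 := by
  funext v
  have hD := covariantBoundary_projTangent_mem (j := j) (U := U) hρ v
  set D := covariantBoundary ρ U (projTangent E ρ U j) v with hDdef
  -- The vector to be shown zero serves as the velocity of the gauge transformation at `v`.
  obtain ⟨c, hc0, hc, hcD⟩ := (mem_tangent_iff hρ).1 hD
  have hγ : ∀ e : Edge d N, (fun t => gaugeTransform (Function.update 1 v (c t)) U e) =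
      if e.start = v then fun t => c t * U e
      else if e.finish = v then fun t => U e * (c t)⁻¹ else fun _ => U e := fun e => by
    funext t
    by_cases hs : e.start = v
    · have hf : e.finish ≠ v := fun hf => e.finish_ne_start (hf.trans hs.symm)
      simp [gaugeTransform, hs, hf]
    · by_cases hf : e.finish = v <;> simp [gaugeTransform, hs, hf]
  have hdiff : ∀ e : Edge d N, MDifferentiableAt 𝓘(ℝ, ℝ) 𝓘(ℝ, E)
      (fun t => gaugeTransform (Function.update 1 v (c t)) U e) 0 := fun e => by
    rw [hγ]
    split_ifs
    · exact mdifferentiableAt_mul_right _ hc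
    · exact mdifferentiableAt_mul_left _ (mdifferentiableAt_inv hc)
    · exact mdifferentiableAt_const
  have hinit : gaugeTransform (Function.update 1 v (c 0)) U = U := by
    funext e
    rw [hc0, ← Pi.one_apply (M := fun _ : Vertex d N => G) v, Function.update_eq_self]
    simp [gaugeTransform]
  have hK : ∀ e : Edge d N, HasEntryDeriv
      (fun t => repMatrix ρ (gaugeTransform (Function.update 1 v (c t)) U e))
      (if e.start = v then D * repMatrix ρ (U e)
        else if e.finish = v then -(repMatrix ρ (U e) * D) else 0) := fun e => by
    change HasEntryDeriv (fun t => repMatrix ρ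
      ((fun t => gaugeTransform (Function.update 1 v (c t)) U e) t)) _
    rw [hγ]
    split_ifs
    · simpa only [repMatrix_mul] using hcD.mul_const _
    · rw [← mul_neg, ← hcD.conjTranspose_eq_neg hc0]
      simpa only [repMatrix_mul, repMatrix_inv] using hcD.conjTranspose.const_mul _
    · exact HasEntryDeriv.const _
  have h0 := (hU _ hinit hdiff).unique (hasDerivAt_action_gaugeTransform hK)
  -- These are velocities of curves through `U(e)`, so pairing them with `j` or with its projection
  -- gives the same value.
  have hKmem : ∀ e : Edge d N, (if e.start = v then D * repMatrix ρ (U e)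
        else if e.finish = v then -(repMatrix ρ (U e) * D) else 0) ∈ tangent E ρ (U e) :=
    fun e => by
      refine (mem_tangent_iff hρ).2 ⟨_, congrFun hinit e, hdiff e, hK e⟩
  have h1 : inner ℝ D D = 0 := by
    -- Only the first `D` is unfolded; the second remains as the test direction.
    conv_lhs => arg 2; rw [hDdef]
    rw [inner_covariantBoundary, h0]
    exact congrArg _ (Finset.sum_congr rfl fun e _ => inner_projTangent e (hKmem e))
  exact inner_self_eq_zero.1 h1

end Equations

end LatticeGauge

theorem mainTheorem10 {d N n : ℕ}
    {E : Type*} [NormedAddCommGroup E] [NormedSpace ℝ E] [FiniteDimensional ℝ E]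
    {G : Type*} [Group G] [TopologicalSpace G] [ChartedSpace E G] [LieGroup 𝓘(ℝ, E) ∞ G]
    (ρ : G →* Matrix.unitaryGroup (Fin n) ℂ) (hρ : LatticeGauge.IsSmoothRep E ρ)
    (j : LatticeGauge.Edge d N → Matrix (Fin n) (Fin n) ℂ)
    (U : LatticeGauge.Edge d N → G) (hU : LatticeGauge.IsGeneratedBy E ρ U j) :
    -LatticeGauge.projTangent E ρ U (LatticeGauge.covariantBoundarySharpCurvature ρ U)
        = LatticeGauge.projTangent E ρ U j ∧
      LatticeGauge.covariantBoundary ρ U (LatticeGauge.projTangent E ρ U j) = 0 :=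
  ⟨LatticeGauge.yangMills_of_isGeneratedBy hρ hU,
    LatticeGauge.covariantBoundary_projTangent_eq_zero hρ hU⟩
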